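/- (a) Let $\alpha$ be an algebraic integer, $K=\mathbb{Q}(\alpha)$, $A=\mathbb{Z}[\alpha]$. Let $\overline{A}$ be the integral closure of $A$ in $K$ and let $A^{\dagger}=\{x\in K : \mathrm{Tr}_{K/\mathbb{Q}}(xA)\subseteq \mathbb{Z}\}$ be its trace dual. Let $p$ be a prime number with $p>[K:\mathbb{Q}]$. Then $p$ divides the exponent of the group $\overline{A}/A$ if and only if $p^2$ divides the exponent of the group $A^{\dagger}/A$. (b) More generally, let $R$ be a Dedekind domain with fraction field $F$, and let $A$ be an order over $R$, that is, a commutative $R$-algebra that is finitely generated and torsion-free as an $R$-module and whose total quotient ring $Q(A)=A\otimes_R F$ is finite étale over $F$ (equivalently, the trace form $(x,y)\mapsto \mathrm{Tr}_{Q(A)/F}(xy)$ is non-degenerate). Let $\overline{A}$ be the integral closure of $A$ in $Q(A)$ and $A^{\dagger}=\{x\in Q(A) : \mathrm{Tr}_{Q(A)/F}(xA)\subseteq R\}$. Let $\mathfrak{p}$ be a nonzero prime ideal of $R$ such that $\mathrm{char}(R/\mathfrak{p})=0$ or $\mathrm{char}(R/\mathfrak{p})>\dim_F Q(A)$. Then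 $\mathfrak{p}$ divides the annihilator ideal $\mathrm{Ann}_R(\overline{A}/A)$ if and only if $\mathfrak{p}^2$ divides $\mathrm{Ann}_R(A^{\dagger}/A)$. -/

import Mathlib

/-! Orders over Dedekind domains. Throughout, `F` is the fraction field of `R`, and `Q` is the
total quotient ring of `A`, which is an algebra over `F`. -/

/-- `A` is an order over `R`: it is finitely generated and torsion-free as an `R`-module, and its
total quotient ring `Q` is finite étale over `F`, that is, the trace form
`(x, y) ↦ Tr_{Q/F}(x y)` is non-degenerate. (Finiteness of `Q` over `F` follows from that of `A`
over `R`.) -/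
structure IsTraceOrder (R F A Q : Type*) [CommRing R] [Field F] [CommRing A] [CommRing Q]
    [Algebra R A] [Algebra F Q] : Prop where
  finite : Module.Finite R A
  torsionFree : Module.IsTorsionFree R A
  etale : (Algebra.traceForm F Q).Nondegenerate

/-- The image of `A` in `Q`, as an `R`-submodule of `Q`. -/
def orderSubmodule (R A Q : Type*) [CommRing R] [CommRing A] [CommRing Q]
    [Algebra R A] [Algebra A Q] [Algebra R Q] [IsScalarTower R A Q] : Submodule R Q :=
  LinearMap.range (IsScalarTower.toAlgHom R A Q).toLinearMap

/-- The integral closure `Ā` of `A` in `Q`, as an `R`-submodule of `Q`. -/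
def closureSubmodule (R A Q : Type*) [CommRing R] [CommRing A] [CommRing Q]
    [Algebra R A] [Algebra A Q] [Algebra R Q] [IsScalarTower R A Q] : Submodule R Q :=
  (Subalgebra.toSubmodule (integralClosure A Q)).restrictScalars R

/-- The trace dual `A† = {x ∈ Q : Tr_{Q/F}(x A) ⊆ R}`, as an `R`-submodule of `Q`. -/
noncomputable def traceDualSubmodule (R F A Q : Type*) [CommRing R] [Field F] [CommRing A] [CommRing Q]
    [Algebra R A] [Algebra A Q] [Algebra R Q] [IsScalarTower R A Q]
    [Algebra R F] [Algebra F Q] [IsScalarTower R F Q] : Submodule R Q :=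
  (Algebra.traceForm F Q).dualSubmodule (orderSubmodule R A Q)

/-- The `R`-module `Ā/A`. -/
abbrev ClosureQuotient (R A Q : Type*) [CommRing R] [CommRing A] [CommRing Q]
    [Algebra R A] [Algebra A Q] [Algebra R Q] [IsScalarTower R A Q] : Type _ :=
  closureSubmodule R A Q ⧸ (orderSubmodule R A Q).submoduleOf (closureSubmodule R A Q)

/-- The `R`-module `A†/A`. -/
abbrev DualQuotient (R F A Q : Type*) [CommRing R] [Field F] [CommRing A] [CommRing Q]
    [Algebra R A] [Algebra A Q] [Algebra R Q] [IsScalarTower R A Q]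
    [Algebra R F] [Algebra F Q] [IsScalarTower R F Q] : Type _ :=
  traceDualSubmodule R F A Q ⧸ (orderSubmodule R A Q).submoduleOf (traceDualSubmodule R F A Q)

/-! Work locally at `P`, that is, up to a factor `s ∉ P`. Negated, the two sides say that `Ā ⊆ A`,
respectively `P A† ⊆ A`, locally at `P`. Let `J` be the radical of `PA`. Over the residue field a
nonzero idempotent has trace equal to its rank, which is nonzero by the assumption on the
characteristic; hence `x ∈ J` iff `Tr(xA) ⊆ P` (`mem_radical_map_iff`), and so `A ∩ P A† ⊆ J`.

Both directions descend on `m`, starting from a power of `J` that carries the module into `A`. If `Ā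
= A`, take `x ∈ J^m P A†` with `J^(m+1) P A† ⊆ A`: then `xJ ⊆ A ∩ P A† ⊆ J`, so `x` is integral and
lies in `A`. Conversely, if `P A† ⊆ A`, then `P A† ⊆ J`. Take `x ∈ J^m Ā` with `J^(m+1) Ā ⊆ A`: then
`xJ ⊆ A`, and even `xJ ⊆ J` because `J` is radical. Hence `Tr(x P A†) ⊆ P`, so `Tr(x A†) ⊆ R` and `x
∈ A†† = A`. -/

open scoped nonZeroDivisors

/-- The total quotient ring of a finite torsion-free algebra `A` over a domain `R` is obtained
by inverting the nonzero elements of `R`. -/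
theorem isLocalization_algebraMapSubmonoid_of_finite (R A Q : Type*) [CommRing R] [IsDomain R]
    [CommRing A] [CommRing Q] [Algebra R A] [Algebra A Q] [IsFractionRing A Q]
    [Module.Finite R A] [Module.IsTorsionFree R A] :
    IsLocalization (Algebra.algebraMapSubmonoid A R⁰) Q := by
  refine (IsLocalization.iff_of_le_of_exists_dvd _ A⁰ ?_ ?_).mpr inferInstance
  · rintro _ ⟨r, hr, rfl⟩
    rw [mem_nonZeroDivisors_iff_right]
    intro x hx
    have h : r • x = 0 := by rw [Algebra.smul_def, mul_comm]; exact hx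
    exact (smul_eq_zero_iff_right (nonZeroDivisors.ne_zero hr)).mp h
  · intro s hs
    obtain ⟨r, hr, h⟩ := (Algebra.IsIntegral.isIntegral (R := R) s).isAlgebraic.exists_nonzero_dvd hs
    exact ⟨_, ⟨r, mem_nonZeroDivisors_of_ne_zero hr, rfl⟩, h⟩

theorem projective_of_finite_of_isTorsionFree (R M : Type*) [CommRing R] [IsDedekindDomain R]
    [AddCommGroup M] [Module R M] [Module.Finite R M] [Module.IsTorsionFree R M] :
    Module.Projective R M :=
  have := Module.finitePresentation_of_finite R M
  Module.Flat.projective_of_finitePresentation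

/-- The trace of an endomorphism computed with a dual pair of generating families. -/
theorem LinearMap.trace_eq_sum_of_dual_family {k V ι : Type*} [Field k] [AddCommGroup V]
    [Module k V] [FiniteDimensional k V] [Fintype ι] (f : ι → V →ₗ[k] k) (a : ι → V)
    (h : ∀ v, v = ∑ i, f i v • a i) (φ : V →ₗ[k] V) :
    LinearMap.trace k V φ = ∑ i, f i (φ (a i)) := by
  have hφ : φ = ∑ i, dualTensorHom k V V (f i ⊗ₜ φ (a i)) := by
    ext v
    conv_lhs => rw [h v]
    simp [dualTensorHom_apply]
  conv_lhs => rw [hφ]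
  simp [LinearMap.trace_eq_contract_apply]

/-! ### Dual families of an order -/

section
variable (R F A Q : Type*) [CommRing R] [IsDedekindDomain R] [Field F] [CommRing A] [CommRing Q]
  [Algebra R F] [IsFractionRing R F] [Algebra R A] [Algebra A Q] [IsFractionRing A Q]
  [Algebra R Q] [Algebra F Q] [IsScalarTower R A Q] [IsScalarTower R F Q]

theorem isLocalizedModule_of_finite [Module.Finite R A] [Module.IsTorsionFree R A] :
    IsLocalizedModule R⁰ (IsScalarTower.toAlgHom R A Q).toLinearMap :=
  isLocalizedModule_iff_isLocalization.mpr (isLocalization_algebraMapSubmonoid_of_finite R A Q)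

theorem finiteDimensional_of_finite [Module.Finite R A] [Module.IsTorsionFree R A] :
    FiniteDimensional F Q :=
  have := isLocalizedModule_of_finite R A Q
  Module.Finite.of_isLocalizedModule (Rₚ := F) R⁰ (IsScalarTower.toAlgHom R A Q).toLinearMap

theorem exists_smul_eq_algebraMap [Module.Finite R A] [Module.IsTorsionFree R A] (q : Q) :
    ∃ r : R, r ≠ 0 ∧ ∃ a : A, r • q = algebraMap A Q a := by
  have := isLocalizedModule_of_finite R A Q
  obtain ⟨⟨a, r⟩, h⟩ := IsLocalizedModule.surj R⁰ (IsScalarTower.toAlgHom R A Q).toLinearMap q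
  exact ⟨r, nonZeroDivisors.ne_zero r.2, a, h⟩

/-- A dual pair of generating families of an order: elements `a i` of `A`, functionals `f i` on
`A`, represented under the trace form by elements `y i` of `Q`. -/
theorem exists_dual_family (h : IsTraceOrder R F A Q) :
    ∃ (n : ℕ) (a : Fin n → A) (f : Fin n → A →ₗ[R] R) (y : Fin n → Q),
      (∀ x, x = ∑ i, f i x • a i) ∧
      (∀ i x, algebraMap R F (f i x) = Algebra.trace F Q (y i * algebraMap A Q x)) ∧
      (∀ q, q = ∑ i, Algebra.trace F Q (y i * q) • algebraMap A Q (a i)) := by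
  have := h.finite
  have := h.torsionFree
  have := finiteDimensional_of_finite R F A Q
  have := isLocalizedModule_of_finite R A Q
  have := projective_of_finite_of_isTorsionFree R A
  -- `A` is a direct summand of `R^n`; the coordinates of the section `g` and the images under `f`
  -- of the standard basis form the dual pair.
  obtain ⟨n, f, g, -, -, hfg⟩ := Module.Finite.exists_comp_eq_id_of_projective R A
  let ι := (IsScalarTower.toAlgHom R A Q).toLinearMap
  have hι (x : A) : ι x = algebraMap A Q x := rfl
  let e (i : Fin n) : Q →ₗ[F] F :=
    (IsLocalizedModule.mapExtendScalars R⁰ ι (Algebra.linearMap R F) F (LinearMap.proj i ∘ₗ g))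
  have he (i : Fin n) (x : A) : e i (algebraMap A Q x) = algebraMap R F (g x i) :=
    IsLocalizedModule.map_apply R⁰ ι (Algebra.linearMap R F) _ x
  let y (i : Fin n) : Q := ((Algebra.traceForm F Q).toDual h.etale).symm (e i)
  have hy (i : Fin n) (q : Q) : Algebra.trace F Q (y i * q) = e i q :=
    LinearMap.BilinForm.apply_toDual_symm_apply (B := Algebra.traceForm F Q) (hB := h.etale) (e i) q
  have hx (x : A) : x = ∑ i, g x i • f (Pi.single i 1) := by
    conv_lhs => rw [← LinearMap.id_apply (R := R) x, ← hfg, LinearMap.comp_apply,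
      pi_eq_sum_univ' (g x)]
    simp
  refine ⟨n, fun i ↦ f (Pi.single i 1), fun i ↦ LinearMap.proj i ∘ₗ g, y, hx, ?_, ?_⟩
  · intro i x
    rw [hy, he]; rfl
  · intro q
    simp only [hy]
    obtain ⟨r, hr, a, ha⟩ := exists_smul_eq_algebraMap R A Q q
    have hr' : algebraMap R F r ≠ 0 := by simpa using hr
    have hq : algebraMap R F r • q = algebraMap A Q a := by rw [← ha, algebraMap_smul]
    have : algebraMap R F r • q =
        algebraMap R F r • ∑ i, e i q • algebraMap A Q (f (Pi.single i 1)) := by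
      rw [hq]
      simp only [Finset.smul_sum, ← smul_assoc, ← map_smul, hq, he]
      conv_lhs => rw [hx a]
      simp [Algebra.smul_def, ← IsScalarTower.algebraMap_apply]
    exact smul_right_injective Q hr' this
end

/-! ### Traces modulo a prime and the radical of `PA` -/

section TraceModPrime
variable {R F A Q : Type*} [CommRing R] [IsDedekindDomain R] [Field F] [CommRing A] [CommRing Q]
  [Algebra R F] [IsFractionRing R F] [Algebra R A] [Algebra A Q] [IsFractionRing A Q]
  [Algebra R Q] [Algebra F Q] [IsScalarTower R A Q] [IsScalarTower R F Q]

/-- `Q` need not be a field, so the trace is written as the sum of the eigenvalues of multiplication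
by `x`. Each eigenvalue is a root of any monic polynomial killing `x`, hence integral over `R`. -/
theorem trace_mem_range_of_isIntegral [FiniteDimensional F Q] {x : Q} (hx : IsIntegral R x) :
    ∃ r : R, algebraMap R F r = Algebra.trace F Q x := by
  refine IsIntegrallyClosed.isIntegral_iff.mp ?_
  let b := Module.finBasis F Q
  let i := algebraMap F (AlgebraicClosure F)
  let M := (Algebra.leftMulMatrix b x).map i
  rw [← isIntegral_algebraMap_iff i.injective, Algebra.trace_eq_matrix_trace b,
    show algebraMap F (AlgebraicClosure F) (Algebra.leftMulMatrix b x).trace = M.trace from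
      AddMonoidHom.map_trace i.toAddMonoidHom _,
    Matrix.trace_eq_sum_roots_charpoly]
  refine IsIntegral.multiset_sum fun μ hμ ↦ ?_
  rcases isEmpty_or_nonempty (Fin (Module.finrank F Q)) with _ | _
  · simp at hμ
  obtain ⟨p, hp, hpx⟩ := hx
  refine ⟨p, hp, ?_⟩
  let q := p.map (algebraMap R (AlgebraicClosure F))
  have hq : Polynomial.aeval M q = 0 := by
    have h1 : Polynomial.aeval (Algebra.leftMulMatrix b x) (p.map (algebraMap R F)) = 0 := by
      rw [Polynomial.aeval_algHom_apply, Polynomial.aeval_map_algebraMap, Polynomial.aeval_def,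
        hpx, map_zero]
    have h2 := congrArg (i.mapMatrix) h1
    rw [map_zero, Polynomial.aeval_def, Polynomial.hom_eval₂] at h2
    rw [← h2, Polynomial.aeval_def, Polynomial.eval₂_map, Polynomial.eval₂_map]
    congr 1
    ext r j k : 3
    by_cases hjk : j = k <;>
      simp [i, Matrix.algebraMap_matrix_apply, hjk,
        IsScalarTower.algebraMap_apply R F (AlgebraicClosure F)]
  have hμ' : μ ∈ spectrum (AlgebraicClosure F) M :=
    Matrix.mem_spectrum_of_isRoot_charpoly (Polynomial.isRoot_of_mem_roots hμ)
  have h := spectrum.subset_polynomial_aeval M q ⟨μ, hμ', rfl⟩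
  rw [hq, spectrum.zero_eq, Set.mem_singleton_iff] at h
  simpa [q, Polynomial.eval_map] using h

/-- The reduction of an `R`-linear functional on `A` modulo an ideal. -/
noncomputable def LinearMap.modIdeal (P : Ideal R) (f : A →ₗ[R] R) :
    (A ⧸ P.map (algebraMap R A)) →ₗ[R ⧸ P] R ⧸ P :=
  let g : (A ⧸ P.map (algebraMap R A)) →ₗ[R] R ⧸ P :=
    ((P.map (algebraMap R A)).restrictScalars R).liftQ ((Submodule.mkQ P) ∘ₗ f) (by
      intro x hx
      rw [← Ideal.smul_top_eq_map] at hx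
      rw [LinearMap.mem_ker, LinearMap.comp_apply, Submodule.mkQ_apply,
        Submodule.Quotient.mk_eq_zero]
      induction hx using Submodule.smul_induction_on' with
      | smul r hr x _ => rw [map_smul]; exact P.mul_mem_right _ hr
      | add x _ y _ hx hy => rw [map_add]; exact add_mem hx hy)
  LinearMap.extendScalarsOfSurjective (R := R) (S := R ⧸ P) (M := A ⧸ P.map (algebraMap R A))
    (N := R ⧸ P) Ideal.Quotient.mk_surjective g

omit [IsDedekindDomain R] in
theorem LinearMap.modIdeal_mk (P : Ideal R) (f : A →ₗ[R] R) (x : A) :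
    f.modIdeal P (Ideal.Quotient.mk _ x) = Ideal.Quotient.mk P (f x) := rfl

/-- The trace of `A` reduces modulo `P` to the trace of `A ⧸ PA`. -/
theorem exists_trace_eq_and_trace_quotient (h : IsTraceOrder R F A Q) (P : Ideal R)
    [P.IsMaximal] (x : A) :
    ∃ t : R, algebraMap R F t = Algebra.trace F Q (algebraMap A Q x) ∧
      Ideal.Quotient.mk P t = Algebra.trace (R ⧸ P) (A ⧸ P.map (algebraMap R A))
        (Ideal.Quotient.mk _ x) := by
  have := h.finite
  have := h.torsionFree
  have := finiteDimensional_of_finite R F A Q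
  obtain ⟨n, a, f, y, hf, hfy, hy⟩ := exists_dual_family R F A Q h
  let := Ideal.Quotient.field P
  have : Module.Finite (R ⧸ P) (A ⧸ P.map (algebraMap R A)) :=
    Module.Finite.of_restrictScalars_finite R _ _
  refine ⟨∑ i, f i (x * a i), ?_, ?_⟩
  · rw [Algebra.trace_apply, LinearMap.trace_eq_sum_of_dual_family
      (fun i ↦ Algebra.traceForm F Q (y i)) (fun i ↦ algebraMap A Q (a i))
      (fun v ↦ by simpa using hy v), map_sum]
    refine Finset.sum_congr rfl fun i _ ↦ ?_
    rw [hfy]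
    simp [Algebra.traceForm_apply]
  · rw [Algebra.trace_apply, LinearMap.trace_eq_sum_of_dual_family
      (fun i ↦ (f i).modIdeal P) (fun i ↦ Ideal.Quotient.mk _ (a i)) ?_, map_sum]
    · refine Finset.sum_congr rfl fun i _ ↦ ?_
      rw [Algebra.coe_lmul_eq_mul, LinearMap.mul_apply', ← map_mul, LinearMap.modIdeal_mk]
    · intro v
      obtain ⟨v, rfl⟩ := Ideal.Quotient.mk_surjective v
      conv_lhs => rw [hf v]
      rw [map_sum]
      refine Finset.sum_congr rfl fun i _ ↦ ?_
      rw [LinearMap.modIdeal_mk, Algebra.smul_def, map_mul, Algebra.smul_def]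
      rfl

/-- Lifts of a residue basis stay independent over `F`. This carries the bound on the characteristic
from `Q` to `A ⧸ PA`. -/
theorem finrank_quotient_le (h : IsTraceOrder R F A Q) (P : Ideal R) [P.IsMaximal] :
    Module.finrank (R ⧸ P) (A ⧸ P.map (algebraMap R A)) ≤ Module.finrank F Q := by
  have := h.finite
  have := h.torsionFree
  have := finiteDimensional_of_finite R F A Q
  let := Ideal.Quotient.field P
  have : Module.Finite (R ⧸ P) (A ⧸ P.map (algebraMap R A)) :=
    Module.Finite.of_restrictScalars_finite R _ _
  let b := Module.finBasis (R ⧸ P) (A ⧸ P.map (algebraMap R A))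
  choose c hc using fun i ↦ Ideal.Quotient.mk_surjective (b i)
  have hli := b.linearIndependent
  have : LinearIndependent F ((IsScalarTower.toAlgHom R A Q).toLinearMap ∘ c) := by
    refine Ideal.FinrankQuotientMap.linearIndependent_of_nontrivial (S := R ⧸ P) F ?_ _
      (IsFractionRing.injective A Q) (Ideal.Quotient.mkₐ R (P.map (algebraMap R A))).toLinearMap ?_
    · rw [Ideal.Quotient.algebraMap_eq, Ideal.mk_ker]
      exact Ideal.IsPrime.ne_top'
    · have hbc : (Ideal.Quotient.mkₐ R (P.map (algebraMap R A))).toLinearMap ∘ c = ⇑b := funext hc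
      rw [hbc]
      exact hli
  simpa using this.fintype_card_le_finrank

/-- If all multiples of `x` have trace zero in an algebra whose dimension is less than the
characteristic, then `x` is nilpotent. -/
theorem isNilpotent_of_trace_mul_eq_zero {k B : Type*} [Field k] [CommRing B] [Algebra k B]
    [FiniteDimensional k B] (hk : ringChar k = 0 ∨ Module.finrank k B < ringChar k) {x : B}
    (hx : ∀ b, Algebra.trace k B (x * b) = 0) : IsNilpotent x := by
  have : IsArtinianRing B := IsArtinianRing.of_finite k B
  obtain ⟨n, y, hy⟩ := IsArtinian.exists_pow_succ_smul_dvd x (1 : B)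
  simp only [smul_eq_mul, mul_one, Nat.succ_eq_add_one] at hy
  have hpow (m : ℕ) : x ^ n * (x * y) ^ m = x ^ n := by
    induction m with
    | zero => simp
    | succ m ih => rw [pow_succ, ← mul_assoc, ih, ← mul_assoc, ← pow_succ, hy]
  -- The exponent is `n + 1` rather than `n` so that the idempotent is a multiple of `x` even when
  -- `n = 0`, and thus has trace zero.
  have he : IsIdempotentElem ((x * y) ^ (n + 1)) := by
    calc (x * y) ^ (n + 1) * (x * y) ^ (n + 1)
        = y ^ (n + 1) * x * (x ^ n * (x * y) ^ (n + 1)) := by ring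
      _ = (x * y) ^ (n + 1) := by rw [hpow]; ring
  have hE : IsIdempotentElem (Algebra.lmul k B ((x * y) ^ (n + 1))) := he.map _
  have htr : ((Module.finrank k (LinearMap.range (Algebra.lmul k B ((x * y) ^ (n + 1)))) : ℕ) : k)
      = 0 := by
    rw [← (LinearMap.IsIdempotentElem.isProj_range _ hE).trace, ← Algebra.trace_apply, pow_succ',
      mul_assoc]
    exact hx _
  have hzero : Module.finrank k (LinearMap.range (Algebra.lmul k B ((x * y) ^ (n + 1)))) = 0 := by
    rw [ringChar.spec] at htr
    rcases hk with hk | hk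
    · rwa [hk, zero_dvd_iff] at htr
    · exact Nat.eq_zero_of_dvd_of_lt htr ((Submodule.finrank_le _).trans_lt hk)
  have hlmul : Algebra.lmul k B ((x * y) ^ (n + 1)) = 0 :=
    LinearMap.range_eq_bot.mp (Submodule.finrank_eq_zero.mp hzero)
  refine ⟨n, ?_⟩
  have : (x * y) ^ (n + 1) = 0 := by simpa using LinearMap.congr_fun hlmul 1
  rw [← hpow (n + 1), this, mul_zero]

/-- Reduce modulo `P`: nilpotents have trace zero, and the converse is
`isNilpotent_of_trace_mul_eq_zero`, the only place where the characteristic matters. -/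
theorem mem_radical_map_iff (h : IsTraceOrder R F A Q) {P : Ideal R} [P.IsMaximal]
    (hP : ringChar (R ⧸ P) = 0 ∨ Module.finrank F Q < ringChar (R ⧸ P)) (x : A) :
    x ∈ (P.map (algebraMap R A)).radical ↔
      ∀ a : A, ∃ t ∈ P, algebraMap R F t = Algebra.trace F Q (algebraMap A Q (x * a)) := by
  have := h.finite
  let := Ideal.Quotient.field P
  have : Module.Finite (R ⧸ P) (A ⧸ P.map (algebraMap R A)) :=
    Module.Finite.of_restrictScalars_finite R _ _
  have hnil : x ∈ (P.map (algebraMap R A)).radical ↔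
      IsNilpotent (Ideal.Quotient.mk (P.map (algebraMap R A)) x) := by
    simp only [Ideal.mem_radical_iff, IsNilpotent, ← map_pow, Ideal.Quotient.eq_zero_iff_mem]
  rw [hnil]
  constructor
  · intro hx a
    obtain ⟨t, ht, ht'⟩ := exists_trace_eq_and_trace_quotient h P (x * a)
    refine ⟨t, ?_, ht⟩
    rw [← Ideal.Quotient.eq_zero_iff_mem, ht', map_mul]
    exact (Algebra.isNilpotent_trace_of_isNilpotent
      (Commute.isNilpotent_mul_right (Commute.all _ _) hx)).eq_zero
  · intro hx
    refine isNilpotent_of_trace_mul_eq_zero (k := R ⧸ P)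
      (hP.imp_right (finrank_quotient_le h P).trans_lt) fun b ↦ ?_
    obtain ⟨a, rfl⟩ := Ideal.Quotient.mk_surjective b
    obtain ⟨t, ht, ht'⟩ := exists_trace_eq_and_trace_quotient h P (x * a)
    obtain ⟨s, hs, hs'⟩ := hx a
    rw [← map_mul, ← ht', Ideal.Quotient.eq_zero_iff_mem,
      IsFractionRing.injective R F (ht.trans hs'.symm)]
    exact hs
end TraceModPrime

/-! ### The trace dual, localization at `P`, and integrality -/

section Lattices
variable (R F A Q : Type*) [CommRing R] [IsDedekindDomain R] [Field F] [CommRing A] [CommRing Q]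
  [Algebra R F] [IsFractionRing R F] [Algebra R A] [Algebra A Q] [IsFractionRing A Q]
  [Algebra R Q] [Algebra F Q] [IsScalarTower R A Q] [IsScalarTower R F Q]

omit [IsDedekindDomain R] [IsFractionRing R F] [IsFractionRing A Q] in
variable {R F A Q} in
theorem mem_traceDualSubmodule_iff {x : Q} :
    x ∈ traceDualSubmodule R F A Q ↔
      ∀ a : A, ∃ r : R, algebraMap R F r = Algebra.trace F Q (x * algebraMap A Q a) := by
  simp only [traceDualSubmodule, LinearMap.BilinForm.mem_dualSubmodule, orderSubmodule,
    Submodule.mem_one, Algebra.traceForm_apply]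
  constructor
  · exact fun h a ↦ h _ ⟨a, rfl⟩
  · rintro h _ ⟨a, rfl⟩
    exact h a

/-- The trace dual, as an `A`-submodule of `Q`. -/
noncomputable def traceDualIdeal : Submodule A Q where
  carrier := traceDualSubmodule R F A Q
  add_mem' := add_mem
  zero_mem' := zero_mem _
  smul_mem' c x hx := by
    rw [SetLike.mem_coe, mem_traceDualSubmodule_iff] at hx ⊢
    intro a
    obtain ⟨r, hr⟩ := hx (c * a)
    refine ⟨r, hr.trans (congrArg _ ?_)⟩
    rw [Algebra.smul_def, map_mul, mul_left_comm, mul_assoc]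

variable {R F A Q}

omit [IsDedekindDomain R] [IsFractionRing R F] [IsFractionRing A Q] in
theorem mem_traceDualIdeal_iff {x : Q} :
    x ∈ traceDualIdeal R F A Q ↔
      ∀ a : A, ∃ r : R, algebraMap R F r = Algebra.trace F Q (x * algebraMap A Q a) :=
  mem_traceDualSubmodule_iff

/-- An order is equal to its double trace dual. -/
theorem mem_one_of_trace_mul_traceDualIdeal (h : IsTraceOrder R F A Q) {x : Q}
    (hx : ∀ d ∈ traceDualIdeal R F A Q, ∃ r : R, algebraMap R F r = Algebra.trace F Q (d * x)) :
    x ∈ (1 : Submodule A Q) := by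
  obtain ⟨n, a, f, y, -, hf, hy⟩ := exists_dual_family R F A Q h
  choose r hr using fun i ↦ hx (y i) (mem_traceDualIdeal_iff.mpr fun b ↦ ⟨f i b, hf i b⟩)
  rw [Submodule.mem_one]
  refine ⟨∑ i, r i • a i, ?_⟩
  conv_rhs => rw [hy x]
  simp [← hr, Algebra.smul_def, ← IsScalarTower.algebraMap_apply]

/-- Take `r` to be a common denominator of the `y i` in the expansion `d = ∑ Tr(y i * d) a i`. -/
theorem exists_smul_traceDualIdeal_mem_one (h : IsTraceOrder R F A Q) :
    ∃ r : R, r ≠ 0 ∧ ∀ d ∈ traceDualIdeal R F A Q, r • d ∈ (1 : Submodule A Q) := by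
  have := h.finite
  have := h.torsionFree
  obtain ⟨n, a, f, y, -, -, hy⟩ := exists_dual_family R F A Q h
  have := isLocalizedModule_of_finite R A Q
  obtain ⟨r, hr⟩ := IsLocalizedModule.exist_integer_multiples_of_finite R⁰
    (IsScalarTower.toAlgHom R A Q).toLinearMap y
  choose b hb using hr
  refine ⟨r, nonZeroDivisors.ne_zero r.2, fun d hd ↦ ?_⟩
  choose t ht using mem_traceDualIdeal_iff.mp hd
  rw [Submodule.mem_one]
  refine ⟨∑ i, t (b i) • a i, ?_⟩
  have hb' (i : Fin n) : (r : R) • y i = algebraMap A Q (b i) := (hb i).symm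
  conv_rhs => rw [hy d, Finset.smul_sum]
  rw [map_sum]
  refine Finset.sum_congr rfl fun i _ ↦ ?_
  have htr : (r : R) • Algebra.trace F Q (y i * d) = algebraMap R F (t (b i)) := by
    rw [ht, ← hb', mul_smul_comm, ← algebraMap_smul F (r : R) (d * y i), map_smul,
      algebraMap_smul, mul_comm]
  rw [← smul_assoc, htr, algebraMap_smul, Algebra.smul_def, Algebra.smul_def, map_mul,
    ← IsScalarTower.algebraMap_apply]

theorem integralClosure_le_traceDualIdeal (h : IsTraceOrder R F A Q) :
    Subalgebra.toSubmodule (integralClosure A Q) ≤ traceDualIdeal R F A Q := by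
  have := h.finite
  have := h.torsionFree
  have := finiteDimensional_of_finite R F A Q
  intro x hx
  rw [mem_traceDualIdeal_iff]
  intro a
  refine trace_mem_range_of_isIntegral (isIntegral_trans (R := R) (A := A) _ ?_)
  exact IsIntegral.mul hx isIntegral_algebraMap

/-- Up to an element prime to `P`, a nonzero element of `R` divides all elements of a power
of `P`. -/
theorem exists_notMem_pow_dvd {P : Ideal R} [hPp : P.IsPrime] (hP : P ≠ ⊥) {r : R} (hr : r ≠ 0) :
    ∃ (e : ℕ), r ∈ P ^ e ∧ ∃ s ∉ P, ∀ x ∈ P ^ e, r ∣ s * x := by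
  have hr' : Ideal.span {r} ≠ 0 := by simpa using hr
  obtain ⟨C, hC, hdvd⟩ := (FiniteMultiplicity.of_prime_left (Ideal.prime_of_isPrime hP hPp)
    hr').exists_eq_pow_mul_and_not_dvd
  rw [Ideal.dvd_iff_le, SetLike.not_le_iff_exists] at hdvd
  obtain ⟨s, hsC, hsP⟩ := hdvd
  refine ⟨multiplicity P (Ideal.span {r}), ?_, s, hsP, fun x hx ↦ ?_⟩
  · exact Ideal.mul_le_left (hC ▸ Ideal.mem_span_singleton_self r)
  · rw [← Ideal.mem_span_singleton, hC, mul_comm s x]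
    exact Ideal.mul_mem_mul hx hsC

theorem exists_notMem_dvd_of_notMem_sq {P : Ideal R} [P.IsPrime] (hP : P ≠ ⊥) {t : R}
    (ht : t ∉ P ^ 2) : ∃ s ∉ P, ∀ x ∈ P, t ∣ s * x := by
  obtain ⟨e, hte, s, hs, h⟩ := exists_notMem_pow_dvd hP
    (r := t) (fun h0 ↦ ht (h0 ▸ zero_mem _))
  have he : e ≤ 1 := by
    by_contra! he
    exact ht (Ideal.pow_le_pow_right he hte)
  exact ⟨s, hs, fun x hx ↦ h x (Ideal.pow_le_pow_right he (by simpa using hx))⟩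

theorem exists_mem_notMem_sq {P : Ideal R} [hPp : P.IsPrime] (hP : P ≠ ⊥) : ∃ t ∈ P, t ∉ P ^ 2 := by
  have : P ^ 2 < P := by
    simpa using Ideal.pow_succ_lt_pow (P := P) hP 1
  obtain ⟨t, ht, ht'⟩ := SetLike.exists_of_lt this
  exact ⟨t, ht, ht'⟩

/-- An element of an algebra stabilising a finitely generated submodule which contains a
regular element is integral. -/
theorem isIntegral_of_mul_mem_of_isRegular {A Q : Type*} [CommRing A] [CommRing Q] [Algebra A Q]
    {N : Submodule A Q} (hN : N.FG) {u : Q} (hu : u ∈ N) (hreg : IsRegular u) {y : Q}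
    (hy : ∀ n ∈ N, y * n ∈ N) : IsIntegral A y := by
  have : Module.Finite A N := Module.Finite.iff_fg.mpr hN
  let φ : Module.End A N := (LinearMap.mulLeft A y).restrict hy
  obtain ⟨p, hp, hpφ⟩ := LinearMap.exists_monic_and_aeval_eq_zero A φ
  refine ⟨p, hp, ?_⟩
  -- Since `φ` is multiplication by `y`, the relation `p(φ) = 0` gives `p(y) u = 0`, and `u` can be
  -- cancelled.
  have key (q : Polynomial A) (n : N) :
      ((Polynomial.aeval φ q n : N) : Q) = Polynomial.aeval y q * n := by
    induction q using Polynomial.induction_on' generalizing n with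
    | add p q hp hq => simp [hp, hq, add_mul]
    | monomial k a =>
      have hpow : (((φ ^ k) n : N) : Q) = y ^ k * n := by
        induction k with
        | zero => simp
        | succ k ih =>
          rw [pow_succ', Module.End.mul_apply, pow_succ', mul_assoc, ← ih]
          rfl
      simp [Polynomial.aeval_monomial, hpow, Algebra.smul_def, mul_assoc, Module.algebraMap_end_apply]
  have h := key p ⟨u, hu⟩
  rw [hpφ] at h
  exact hreg.right (by simpa [Polynomial.aeval_def] using h.symm)

end Lattices

/-! ### The two descending inductions -/

section Core
variable {R F A Q : Type*} [CommRing R] [IsDedekindDomain R] [Field F] [CommRing A] [CommRing Q]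
  [Algebra R F] [IsFractionRing R F] [Algebra R A] [Algebra A Q] [IsFractionRing A Q]
  [Algebra R Q] [Algebra F Q] [IsScalarTower R A Q] [IsScalarTower R F Q]

omit [IsDedekindDomain R] [IsFractionRing R F] [IsFractionRing A Q] in
theorem trace_mem_of_mem_smul_traceDualIdeal {P : Ideal R} {x : Q}
    (hx : x ∈ P.map (algebraMap R A) • traceDualIdeal R F A Q) :
    ∃ t ∈ P, algebraMap R F t = Algebra.trace F Q x := by
  rw [← Submodule.restrictScalars_mem R, Ideal.smul_restrictScalars] at hx
  induction hx using Submodule.smul_induction_on' with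
  | smul p hp d hd =>
    have hd' : d ∈ traceDualIdeal R F A Q := hd
    obtain ⟨r, hr⟩ := mem_traceDualIdeal_iff.mp hd' 1
    refine ⟨p * r, P.mul_mem_right _ hp, ?_⟩
    rw [map_mul, hr, map_one, mul_one, ← algebraMap_smul F p d, map_smul, smul_eq_mul]
  | add x _ y _ hx hy =>
    obtain ⟨s, hs, hs'⟩ := hx
    obtain ⟨t, ht, ht'⟩ := hy
    exact ⟨s + t, add_mem hs ht, by simp [hs', ht']⟩

theorem mem_radical_of_mem_smul_traceDualIdeal (h : IsTraceOrder R F A Q) {P : Ideal R}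
    [P.IsMaximal] (hP : ringChar (R ⧸ P) = 0 ∨ Module.finrank F Q < ringChar (R ⧸ P)) {b : A}
    (hb : algebraMap A Q b ∈ P.map (algebraMap R A) • traceDualIdeal R F A Q) :
    b ∈ (P.map (algebraMap R A)).radical := by
  rw [mem_radical_map_iff h hP]
  intro a
  refine trace_mem_of_mem_smul_traceDualIdeal (A := A) ?_
  rw [mul_comm, map_mul, ← Algebra.smul_def]
  exact Submodule.smul_mem _ _ hb

/-- Starting point of both inductions. Some `r ≠ 0` maps `A†` into `A` and divides `P^e` up to `s`;
if `J^k ⊆ PA`, then `m = k * e` works. -/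
theorem exists_smul_radical_pow_smul_mem_one (h : IsTraceOrder R F A Q) {P : Ideal R} [P.IsPrime]
    (hP : P ≠ ⊥) {M : Submodule A Q} (hM : M ≤ traceDualIdeal R F A Q) :
    ∃ m, ∃ s ∉ P, ∀ x ∈ (P.map (algebraMap R A)).radical ^ m • M, s • x ∈ (1 : Submodule A Q) := by
  have := h.finite
  have : IsNoetherianRing A := IsNoetherianRing.of_finite R A
  obtain ⟨r, hr, hrd⟩ := exists_smul_traceDualIdeal_mem_one h
  obtain ⟨e, -, s, hs, hdvd⟩ := exists_notMem_pow_dvd hP hr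
  obtain ⟨k, hk⟩ := (P.map (algebraMap R A)).exists_radical_pow_le_of_fg
    (IsNoetherian.noetherian _)
  refine ⟨k * e, s, hs, fun x hx ↦ ?_⟩
  have hx' : x ∈ (P ^ e).map (algebraMap R A) • M := by
    refine Submodule.smul_mono_left ?_ hx
    rw [pow_mul, Ideal.map_pow]
    exact Ideal.pow_right_mono hk e
  rw [← Submodule.restrictScalars_mem R, Ideal.smul_restrictScalars] at hx'
  clear hx
  induction hx' using Submodule.smul_induction_on' with
  | smul p hp d hd =>
    obtain ⟨t, ht⟩ := hdvd p hp
    rw [smul_smul, ht, mul_comm, mul_smul]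
    exact Submodule.smul_of_tower_mem _ t (hrd d (hM hd))
  | add x _ y _ hx hy =>
    rw [smul_add]
    exact add_mem hx hy

omit [IsDedekindDomain R] in
theorem isRegular_algebraMap_of_ne_zero (F Q : Type*) [Field F] [CommRing Q] [Algebra R F]
    [IsFractionRing R F] [Algebra R Q] [Algebra F Q] [IsScalarTower R F Q] {t : R} (ht : t ≠ 0) : IsRegular (algebraMap R Q t) := by
  rw [IsScalarTower.algebraMap_apply R F Q]
  exact ((IsUnit.mk0 _ (by simpa using ht)).map (algebraMap F Q)).isRegular

/-- If `A` is integrally closed locally at `P`, then `P A†` is contained in `A` locally at `P`. -/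
theorem exists_smul_mem_one_of_integralClosure (h : IsTraceOrder R F A Q) {P : Ideal R}
    [hPm : P.IsMaximal] (hP0 : P ≠ ⊥)
    (hP : ringChar (R ⧸ P) = 0 ∨ Module.finrank F Q < ringChar (R ⧸ P))
    (hcl : ∃ s ∉ P, ∀ x ∈ Subalgebra.toSubmodule (integralClosure A Q), s • x ∈ (1 : Submodule A Q)) :
    ∃ s ∉ P, ∀ x ∈ P.map (algebraMap R A) • traceDualIdeal R F A Q,
      s • x ∈ (1 : Submodule A Q) := by
  have := h.finite
  have : IsNoetherianRing A := IsNoetherianRing.of_finite R A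
  obtain ⟨s₀, hs₀, hcl⟩ := hcl
  set I := P.map (algebraMap R A) • traceDualIdeal R F A Q with hI
  set J := (P.map (algebraMap R A)).radical with hJ
  obtain ⟨m, hm⟩ := exists_smul_radical_pow_smul_mem_one h hP0 (M := I) Submodule.smul_le_right
  suffices key : ∀ m, (∃ s ∉ P, ∀ x ∈ J ^ m • I, s • x ∈ (1 : Submodule A Q)) →
      ∃ s ∉ P, ∀ x ∈ I, s • x ∈ (1 : Submodule A Q) from key m hm
  intro m hm
  induction m with
  | zero => simpa using hm
  | succ m ih =>
    obtain ⟨s, hs, hm⟩ := hm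
    refine ih ⟨s₀ * s, hPm.isPrime.mul_notMem hs₀ hs, fun x hx ↦ ?_⟩
    -- It suffices that `s • x` is integral, since `s₀` then moves it into `A`; integrality follows
    -- because `s • x` stabilises `J`.
    rw [mul_smul]
    refine hcl _ ?_
    obtain ⟨t, ht, ht2⟩ := exists_mem_notMem_sq hP0
    have ht0 : t ≠ 0 := fun h0 ↦ ht2 (h0 ▸ zero_mem _)
    have htJ : algebraMap R A t ∈ J := Ideal.le_radical (Ideal.mem_map_of_mem _ ht)
    refine isIntegral_of_mul_mem_of_isRegular (N := Submodule.map (Algebra.linearMap A Q) J)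
      ((IsNoetherian.noetherian J).map _) ⟨_, htJ, rfl⟩ ?_ ?_
    · rw [Algebra.linearMap_apply, ← IsScalarTower.algebraMap_apply]
      exact isRegular_algebraMap_of_ne_zero F Q ht0
    · rintro _ ⟨j, hj, rfl⟩
      have hjx : j • x ∈ J ^ (m + 1) • I := by
        rw [pow_succ', mul_smul]
        exact Submodule.smul_mem_smul hj hx
      obtain ⟨b, hb⟩ := Submodule.mem_one.mp (hm _ hjx)
      have hb' : s • x * algebraMap A Q j = algebraMap A Q b := by
        rw [hb, Algebra.smul_def j, smul_mul_assoc, mul_comm]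
      refine ⟨b, mem_radical_of_mem_smul_traceDualIdeal h hP ?_, hb'.symm⟩
      rw [hb]
      exact Submodule.smul_of_tower_mem _ s (Submodule.smul_le_right hjx)

/-- If `P A†` is contained in `A` locally at `P`, then `A` is integrally closed locally at `P`. -/
theorem exists_integralClosure_smul_mem_one (h : IsTraceOrder R F A Q) {P : Ideal R}
    [hPm : P.IsMaximal] (hP0 : P ≠ ⊥)
    (hP : ringChar (R ⧸ P) = 0 ∨ Module.finrank F Q < ringChar (R ⧸ P))
    (hdual : ∃ s ∉ P, ∀ x ∈ P.map (algebraMap R A) • traceDualIdeal R F A Q,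
      s • x ∈ (1 : Submodule A Q)) :
    ∃ s ∉ P, ∀ x ∈ Subalgebra.toSubmodule (integralClosure A Q), s • x ∈ (1 : Submodule A Q) := by
  obtain ⟨s₀, hs₀, hdual⟩ := hdual
  set I := P.map (algebraMap R A) • traceDualIdeal R F A Q with hI
  set J := (P.map (algebraMap R A)).radical with hJ
  set C := Subalgebra.toSubmodule (integralClosure A Q) with hC
  obtain ⟨m, hm⟩ := exists_smul_radical_pow_smul_mem_one h hP0 (integralClosure_le_traceDualIdeal h)
  suffices key : ∀ m, (∃ s ∉ P, ∀ x ∈ J ^ m • C, s • x ∈ (1 : Submodule A Q)) →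
      ∃ s ∉ P, ∀ x ∈ C, s • x ∈ (1 : Submodule A Q) from key m hm
  intro m hm
  induction m with
  | zero => simpa using hm
  | succ m ih =>
    obtain ⟨s, hs, hm⟩ := hm
    obtain ⟨π, hπ, hπ2⟩ := exists_mem_notMem_sq hP0
    have hπ0 : π ≠ 0 := fun h0 ↦ hπ2 (h0 ▸ zero_mem _)
    obtain ⟨c, hc, hdvd⟩ := exists_notMem_dvd_of_notMem_sq hP0 hπ2
    refine ih ⟨c * s₀ * s, hPm.isPrime.mul_notMem (hPm.isPrime.mul_notMem hc hs₀) hs,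
      fun x hx ↦ ?_⟩
    have hxC : IsIntegral A x := (Submodule.smul_le_right hx : x ∈ C)
    -- multiplication by `s • x` stabilises the radical
    have hstab (j : A) (hj : j ∈ J) : ∃ b ∈ J, algebraMap A Q b = s • x * algebraMap A Q j := by
      have hjx : j • x ∈ J ^ (m + 1) • C := by
        rw [pow_succ', mul_smul]
        exact Submodule.smul_mem_smul hj hx
      obtain ⟨b, hb⟩ := Submodule.mem_one.mp (hm _ hjx)
      have hb' : algebraMap A Q b = s • x * algebraMap A Q j := by
        rw [hb, Algebra.smul_def j, smul_mul_assoc, mul_comm]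
      refine ⟨b, ?_, hb'⟩
      -- One factor `j` is kept aside: `b^(m+2)` is `j` times `s^(m+1) * (s j^(m+1) x^(m+2))`, whose
      -- last factor is in `A`. So `b^(m+2) ∈ J`, and `J` is radical.
      have hjx' : j ^ (m + 1) • x ^ (m + 2) ∈ J ^ (m + 1) • C :=
        Submodule.smul_mem_smul (Ideal.pow_mem_pow hj _) (hxC.pow _)
      obtain ⟨a, ha⟩ := Submodule.mem_one.mp (hm _ hjx')
      have hpow : b ^ (m + 2) = j * (algebraMap R A s ^ (m + 1) * a) := by
        refine IsFractionRing.injective A Q ?_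
        rw [map_pow, hb', map_mul, map_mul, ha, map_pow, ← IsScalarTower.algebraMap_apply,
          Algebra.smul_def, Algebra.smul_def, Algebra.smul_def, map_pow]
        ring
      rw [hJ, ← Ideal.radical_idem, Ideal.mem_radical_iff]
      exact ⟨m + 2, hpow ▸ J.mul_mem_right _ hj⟩
    refine mem_one_of_trace_mul_traceDualIdeal h fun d hd ↦ ?_
    have hπd : π • d ∈ I := by
      rw [← algebraMap_smul A π d]
      exact Submodule.smul_mem_smul (Ideal.mem_map_of_mem _ hπ) hd
    obtain ⟨j, hj⟩ := Submodule.mem_one.mp (hdual _ hπd)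
    have hjJ : j ∈ J := by
      refine mem_radical_of_mem_smul_traceDualIdeal h hP ?_
      rw [hj]
      exact Submodule.smul_of_tower_mem _ s₀ hπd
    obtain ⟨b, hbJ, hb⟩ := hstab j hjJ
    -- `b` is `s₀ s π x d`, so its trace `t` lies in `P`; the factor `c` makes `c t` divisible by
    -- `π`, and cancelling `π` leaves an integral trace.
    obtain ⟨t, ht, htr⟩ := (mem_radical_map_iff h hP b).mp hbJ 1
    obtain ⟨u, hu⟩ := hdvd t ht
    refine ⟨u, ?_⟩
    have hπF : algebraMap R F π ≠ 0 := by simpa using hπ0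
    refine mul_left_cancel₀ hπF ?_
    rw [← map_mul, ← hu, map_mul, htr, mul_one, hb, hj, ← smul_eq_mul (algebraMap R F c),
      ← smul_eq_mul (algebraMap R F π), ← map_smul,
      ← map_smul]
    congr 1
    simp only [Algebra.smul_def, map_mul, ← IsScalarTower.algebraMap_apply]
    ring
end Core

/-! ### Annihilators, exponents, and the criterion -/

theorem mem_annihilator_quotient_submoduleOf_iff {R M : Type*} [CommRing R] [AddCommGroup M]
    [Module R M] (N L : Submodule R M) (r : R) :
    r ∈ Module.annihilator R (L ⧸ N.submoduleOf L) ↔ ∀ x ∈ L, r • x ∈ N := by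
  rw [Module.mem_annihilator]
  constructor
  · intro h x hx
    have := h (Submodule.Quotient.mk ⟨x, hx⟩)
    rwa [← Submodule.Quotient.mk_smul, Submodule.Quotient.mk_eq_zero] at this
  · intro h m
    obtain ⟨x, rfl⟩ := Submodule.Quotient.mk_surjective _ m
    rw [← Submodule.Quotient.mk_smul, Submodule.Quotient.mk_eq_zero]
    exact h x x.2

theorem mem_orderSubmodule_iff {R A Q : Type*} [CommRing R] [CommRing A] [CommRing Q]
    [Algebra R A] [Algebra A Q] [Algebra R Q] [IsScalarTower R A Q] {x : Q} :
    x ∈ orderSubmodule R A Q ↔ x ∈ (1 : Submodule A Q) := by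
  rw [Submodule.mem_one]
  rfl

/-- The criterion for orders over a Dedekind domain. -/
theorem dvd_annihilator_closureQuotient_iff (R F A Q : Type*) [CommRing R] [IsDedekindDomain R]
    [Field F] [CommRing A] [CommRing Q]
    [Algebra R F] [IsFractionRing R F] [Algebra R A] [Algebra A Q] [IsFractionRing A Q]
    [Algebra R Q] [Algebra F Q] [IsScalarTower R A Q] [IsScalarTower R F Q]
    (h : IsTraceOrder R F A Q) (P : Ideal R) (hPp : P.IsPrime) (hP0 : P ≠ ⊥)
    (hP : ringChar (R ⧸ P) = 0 ∨ Module.finrank F Q < ringChar (R ⧸ P)) :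
    P ∣ Module.annihilator R (ClosureQuotient R A Q) ↔
      P ^ 2 ∣ Module.annihilator R (DualQuotient R F A Q) := by
  have : P.IsMaximal := hPp.isMaximal hP0
  rw [← not_iff_not, Ideal.dvd_iff_le, Ideal.dvd_iff_le, SetLike.not_le_iff_exists,
    SetLike.not_le_iff_exists]
  simp only [mem_annihilator_quotient_submoduleOf_iff, mem_orderSubmodule_iff]
  constructor
  · rintro ⟨s, hs, hsP⟩
    obtain ⟨t, htP, ht⟩ := exists_smul_mem_one_of_integralClosure h hP0 hP ⟨s, hsP, hs⟩
    obtain ⟨π, hπ, hπ2⟩ := exists_mem_notMem_sq hP0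
    refine ⟨π * t, fun x hx ↦ ?_, fun hmem ↦ ?_⟩
    · rw [mul_comm, mul_smul]
      refine ht _ ?_
      rw [← algebraMap_smul A π x]
      exact Submodule.smul_mem_smul (Ideal.mem_map_of_mem _ hπ) hx
    -- `π` has valuation exactly one at `P`, so `π * t ∈ P ^ 2` would force `t ∈ P`.
    · exact htP (Ideal.mem_prime_of_mul_mem_pow hP0 hπ2 hmem)
  · rintro ⟨t, ht, htP⟩
    obtain ⟨s, hs, hdvd⟩ := exists_notMem_dvd_of_notMem_sq hP0 htP
    -- Since `t ∉ P ^ 2`, some `s ∉ P` has `s P ⊆ tR`, whence `s P A† ⊆ t A† ⊆ A`.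
    suffices hI : ∀ x ∈ P.map (algebraMap R A) • traceDualIdeal R F A Q,
        s • x ∈ (1 : Submodule A Q) by
      obtain ⟨r, hrP, hr⟩ := exists_integralClosure_smul_mem_one h hP0 hP ⟨s, hs, hI⟩
      exact ⟨r, hr, hrP⟩
    intro x hx
    rw [← Submodule.restrictScalars_mem R, Ideal.smul_restrictScalars] at hx
    induction hx using Submodule.smul_induction_on' with
    | smul p hp d hd =>
      obtain ⟨u, hu⟩ := hdvd p hp
      rw [smul_smul, hu, mul_comm, mul_smul]
      exact Submodule.smul_of_tower_mem _ u (ht d hd)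
    | add x _ y _ hx hy =>
      rw [smul_add]
      exact add_mem hx hy

/-- The exponent generates the annihilator over `ℤ`, including the default value `0` for unbounded
exponent. -/
theorem span_natCast_dvd_annihilator_iff {M : Type*} [AddCommGroup M] [Module ℤ M] (n : ℕ) :
    Ideal.span {(n : ℤ)} ∣ Module.annihilator ℤ M ↔ n ∣ AddMonoid.exponent M := by
  rw [Ideal.dvd_iff_le]
  constructor
  · intro h
    have hmem : (AddMonoid.exponent M : ℤ) ∈ Module.annihilator ℤ M := by
      rw [Module.mem_annihilator]
      intro m
      rw [Nat.cast_smul_eq_nsmul, AddMonoid.exponent_nsmul_eq_zero]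
    simpa [Ideal.mem_span_singleton, Int.natCast_dvd_natCast] using h hmem
  · intro h z hz
    rw [Ideal.mem_span_singleton]
    refine (Int.natCast_dvd_natCast.mpr h).trans ?_
    rw [← Int.dvd_natAbs, Int.natCast_dvd_natCast]
    refine AddMonoid.exponent_dvd_of_forall_nsmul_eq_zero fun m ↦ ?_
    have hm := Module.mem_annihilator.mp hz m
    rw [← Nat.cast_smul_eq_nsmul ℤ]
    rcases Int.natAbs_eq z with h' | h'
    · rwa [← h']
    · rw [h', neg_smul, neg_eq_zero] at hm
      exact hm

/-! ### The order `ℤ[α]` -/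

section NumberField
variable {K : Type*} [Field K] [NumberField K] {α : K}

theorem isFractionRing_adjoin_int (hα : IntermediateField.adjoin ℚ {α} = ⊤) :
    IsFractionRing (Algebra.adjoin ℤ {α}) K := by
  -- Clearing denominators in a polynomial expression in `α` over `ℚ` makes `K` the fraction field
  -- of `ℤ[α]`.
  have key (x : K) : ∃ n : ℤ, n ≠ 0 ∧ n • x ∈ Algebra.adjoin ℤ {α} := by
    have hx : x ∈ Algebra.adjoin ℚ {α} := by
      rw [← IntermediateField.adjoin_simple_toSubalgebra_of_isAlgebraic
        (Algebra.IsAlgebraic.isAlgebraic α), hα]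
      trivial
    induction hx using Algebra.adjoin_induction with
    | mem y hy => exact ⟨1, one_ne_zero, by simpa using Algebra.subset_adjoin hy⟩
    | algebraMap q =>
      refine ⟨q.den, by simp, ?_⟩
      have : (q.den : ℤ) • algebraMap ℚ K q = algebraMap ℤ K q.num := by
        rw [zsmul_eq_mul, eq_intCast, Int.cast_natCast, ← map_natCast (algebraMap ℚ K), ← map_mul,
          Rat.den_mul_eq_num, map_intCast]
      rw [this]
      exact Subalgebra.algebraMap_mem _ _
    | add y z _ _ hy hz =>
      obtain ⟨m, hm, hy⟩ := hy
      obtain ⟨n, hn, hz⟩ := hz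
      refine ⟨m * n, mul_ne_zero hm hn, ?_⟩
      rw [smul_add]
      refine add_mem ?_ ?_
      · rw [mul_comm, mul_smul]; exact Subalgebra.smul_mem _ hy n
      · rw [mul_smul]; exact Subalgebra.smul_mem _ hz m
    | mul y z _ _ hy hz =>
      obtain ⟨m, hm, hy⟩ := hy
      obtain ⟨n, hn, hz⟩ := hz
      refine ⟨m * n, mul_ne_zero hm hn, ?_⟩
      rw [← smul_mul_smul_comm]
      exact mul_mem hy hz
  refine IsFractionRing.of_field _ _ fun z ↦ ?_
  obtain ⟨n, hn, hz⟩ := key z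
  refine ⟨⟨_, hz⟩, algebraMap ℤ _ n, ?_⟩
  have hn' : (n : K) ≠ 0 := by exact_mod_cast hn
  rw [eq_div_iff (by simpa using hn')]
  simp [Algebra.smul_def, mul_comm]

theorem isTraceOrder_adjoin_int (hα : IsIntegral ℤ α) :
    IsTraceOrder ℤ ℚ (Algebra.adjoin ℤ {α}) K where
  finite := Module.Finite.iff_fg.mpr hα.fg_adjoin_singleton
  torsionFree := inferInstance
  etale := traceForm_nondegenerate ℚ K

end NumberField

theorem theorem1 :
    -- the order `A = ℤ[α]` in the number field `K = ℚ(α)`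
    (∀ (K : Type*) [Field K] [NumberField K] (α : K),
      IsIntegral ℤ α → IntermediateField.adjoin ℚ {α} = ⊤ →
      ∀ p : ℕ, p.Prime → Module.finrank ℚ K < p →
        (p ∣ AddMonoid.exponent (ClosureQuotient ℤ (Algebra.adjoin ℤ {α}) K) ↔
          p ^ 2 ∣ AddMonoid.exponent (DualQuotient ℤ ℚ (Algebra.adjoin ℤ {α}) K))) ∧
    -- an arbitrary order `A` over a Dedekind domain `R`
    (∀ (R F A Q : Type*) [CommRing R] [IsDedekindDomain R] [Field F] [CommRing A] [CommRing Q]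
      [Algebra R F] [IsFractionRing R F] [Algebra R A] [Algebra A Q] [IsFractionRing A Q]
      [Algebra R Q] [Algebra F Q] [IsScalarTower R A Q] [IsScalarTower R F Q],
      IsTraceOrder R F A Q →
      ∀ P : Ideal R, P.IsPrime → P ≠ ⊥ →
        (ringChar (R ⧸ P) = 0 ∨ Module.finrank F Q < ringChar (R ⧸ P)) →
        (P ∣ Module.annihilator R (ClosureQuotient R A Q) ↔
          P ^ 2 ∣ Module.annihilator R (DualQuotient R F A Q))) := by
  refine ⟨fun K _ _ α hα hK p hp hlt ↦ ?_, fun R F A Q ↦ ?_⟩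
  · have := isFractionRing_adjoin_int hK
    have hchar : ringChar (ℤ ⧸ Ideal.span {(p : ℤ)}) = p := by
      have := Fact.mk hp
      have := CharP.quotient ℤ p (Nat.prime_iff_prime_int.mp hp).not_isUnit
      exact ringChar.eq_iff.mpr this
    rw [← span_natCast_dvd_annihilator_iff, ← span_natCast_dvd_annihilator_iff, Nat.cast_pow,
      ← Ideal.span_singleton_pow]
    refine dvd_annihilator_closureQuotient_iff ℤ ℚ _ K (isTraceOrder_adjoin_int hα) _ ?_ ?_ ?_
    · exact (Ideal.span_singleton_prime (by exact_mod_cast hp.ne_zero)).mpr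
        (Nat.prime_iff_prime_int.mp hp)
    · simpa using hp.ne_zero
    · exact Or.inr (hchar.symm ▸ hlt)
  · intros
    exact dvd_annihilator_closureQuotient_iff R F A Q ‹_› _ ‹_› ‹_› ‹_›
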